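/- Consider a discrete memoryless broadcast interference channel with finite input alphabets $\mathcal X_1,\mathcal X_2$, finite output alphabets $\mathcal Y_1,\mathcal Y_2,\mathcal Y_3$ and transition probability $$p(y_1,y_2,y_3\mid x_1,x_2)=p(y_1\mid x_1)\,p(y_2\mid x_1,x_2)\,p(y_3\mid x_2).$$ Write $Y_1\prec_o Y_2$ (receiver 2 is interference-oblivious less noisy than receiver 1) if $I(U_1;Y_1)\le I(U_1;Y_2)$, and $Y_1\succ_c Y_2$ (receiver 1 is interference-cognizant less noisy than receiver 2) if $I(U_1;Y_1)\ge I(U_1;Y_2\mid X_2)$, in each case for every finite alphabet of $U_1$ and every input distribution $p(u_1,x_1)p(x_2)$ such that $U_1\to(X_1,X_2)\to(Y_1,Y_2)$ is a Markov chain. Let $\mathcal P'$ be the set of all distributions $P=P_{U_1}(u_1)P_{X_1|U_1}(x_1|u_1)P_{U_2}(u_2)P_{X_2|U_2}(x_2|u_2)$, where $U_1,U_2$ range over arbitrary finite alphabets and $(U_1,U_2)\to(X_1,X_2)\to(Y_1,Y_2,Y_3)$ is a Markov chain. For $P\in\mathcal P'$ define the following sets of triples $(R_1,R_2,R_3)$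 of non-negative reals. * $\mathcal R_{1,P}$: $R_1\le I(U_1;Y_1)$, $R_3\le I(X_2;Y_3)$, $R_1+R_2\le I(U_1;Y_1)+I(X_1;Y_2|U_1,U_2)$, $R_1+R_2+R_3\le I(U_1;Y_1)+I(X_1,U_2;Y_2|U_1)+I(X_2;Y_3|U_2)$. * $\mathcal R_{(1),P}$: $R_1\le I(U_1;Y_1)$, $R_2\le I(X_1;Y_2|U_1,U_2)$, $R_3\le I(X_2;Y_3)$, $R_2+R_3\le I(X_1,U_2;Y_2|U_1)+I(X_2;Y_3|U_2)$. * $\mathcal R_{2,P}$: $R_2\le I(U_1;Y_2|U_2)$, $R_3\le I(X_2;Y_3)$, $R_1+R_2\le I(X_1;Y_1|U_1)+I(U_1;Y_2|U_2)$, $R_2+R_3\le I(U_1,U_2;Y_2)+I(X_2;Y_3|U_2)$, $R_1+R_2+R_3\le I(X_1;Y_1|U_1)+I(U_1,U_2;Y_2)+I(X_2;Y_3|U_2)$. * $\mathcal R_{(2),P}$: $R_1\le I(X_1;Y_1|U_1)$, $R_2\le I(U_1;Y_2|U_2)$, $R_3\le I(X_2;Y_3)$, $R_2+R_3\le I(U_1,U_2;Y_2)+I(X_2;Y_3|U_2)$.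 Let $\mathcal R_i=\bigcup_{P\in\mathcal P'}\mathcal R_{i,P}$ and $\mathcal R_{(i)}=\bigcup_{P\in\mathcal P'}\mathcal R_{(i),P}$ for $i=1,2$. Then $$Y_1\prec_o Y_2\ \Longrightarrow\ \mathcal R_1=\mathcal R_{(1)},\qquad\qquad Y_1\succ_c Y_2\ \Longrightarrow\ \mathcal R_2=\mathcal R_{(2)}.$$ -/

import Mathlib

noncomputable section

namespace BIC

/-! ### Information measures on a finite probability space (logarithms to base 2) -/

section Information

variable {Ω α β γ : Type*} [Fintype Ω] [Fintype α] [Fintype β] [Fintype γ]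

open scoped Classical in
/-- The law of the random variable `X` when `p` is the probability mass function on `Ω`:
`law p X a = Pr(X = a)`. -/
def law (p : Ω → ℝ) (X : Ω → α) (a : α) : ℝ := ∑ ω, if X ω = a then p ω else 0

/-- Shannon entropy `H(X) = -∑ₐ Pr(X = a) log₂ Pr(X = a)`, with `0 log 0 = 0`. -/
def entropy (p : Ω → ℝ) (X : Ω → α) : ℝ := ∑ a, Real.negMulLog (law p X a) / Real.log 2

/-- Conditional entropy `H(X | Y) = H(X, Y) - H(Y)`. -/
def condEntropy (p : Ω → ℝ) (X : Ω → α) (Y : Ω → β) : ℝ :=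
  entropy p (fun ω => (X ω, Y ω)) - entropy p Y

/-- Mutual information `I(X ; Y) = H(X) - H(X | Y)`. -/
def mutualInfo (p : Ω → ℝ) (X : Ω → α) (Y : Ω → β) : ℝ :=
  entropy p X - condEntropy p X Y

/-- Conditional mutual information `I(X ; Y | Z) = H(X | Z) - H(X | Y, Z)`. -/
def condMutualInfo (p : Ω → ℝ) (X : Ω → α) (Y : Ω → β) (Z : Ω → γ) : ℝ :=
  condEntropy p X Z - condEntropy p X (fun ω => (Y ω, Z ω))

end Information

/-! ### The channel -/

/-- A discrete memoryless broadcast interference channel with finite alphabets: the transition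
probability is `p(y₁, y₂, y₃ | x₁, x₂) = p(y₁ | x₁) p(y₂ | x₁, x₂) p(y₃ | x₂)`. -/
structure Channel (𝒳₁ 𝒳₂ 𝒴₁ 𝒴₂ 𝒴₃ : Type*) [Fintype 𝒴₁] [Fintype 𝒴₂] [Fintype 𝒴₃] where
  /-- `p(y₁ | x₁)` -/
  W₁ : 𝒳₁ → stdSimplex ℝ 𝒴₁
  /-- `p(y₂ | x₁, x₂)` -/
  W₂ : 𝒳₁ → 𝒳₂ → stdSimplex ℝ 𝒴₂
  /-- `p(y₃ | x₂)` -/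
  W₃ : 𝒳₂ → stdSimplex ℝ 𝒴₃

/-- The input distributions
`P(u₁, x₁, u₂, x₂) = P(u₁) P(x₁ | u₁) P(u₂) P(x₂ | u₂)`. -/
structure InputDist (𝒰₁ 𝒳₁ 𝒰₂ 𝒳₂ : Type*)
    [Fintype 𝒰₁] [Fintype 𝒳₁] [Fintype 𝒰₂] [Fintype 𝒳₂] where
  /-- `P(u₁)` -/
  pU₁ : stdSimplex ℝ 𝒰₁
  /-- `P(x₁ | u₁)` -/
  pX₁ : 𝒰₁ → stdSimplex ℝ 𝒳₁
  /-- `P(u₂)` -/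
  pU₂ : stdSimplex ℝ 𝒰₂
  /-- `P(x₂ | u₂)` -/
  pX₂ : 𝒰₂ → stdSimplex ℝ 𝒳₂

/-- An outcome of all the random variables `U₁, X₁, U₂, X₂, Y₁, Y₂, Y₃`. -/
abbrev Outcome (𝒰₁ 𝒳₁ 𝒰₂ 𝒳₂ 𝒴₁ 𝒴₂ 𝒴₃ : Type*) := 𝒰₁ × 𝒳₁ × 𝒰₂ × 𝒳₂ × 𝒴₁ × 𝒴₂ × 𝒴₃

section Coordinates

variable {𝒰₁ 𝒳₁ 𝒰₂ 𝒳₂ 𝒴₁ 𝒴₂ 𝒴₃ : Type*}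

/-- The random variable `U₁`. -/
def U₁ (ω : Outcome 𝒰₁ 𝒳₁ 𝒰₂ 𝒳₂ 𝒴₁ 𝒴₂ 𝒴₃) : 𝒰₁ := ω.1
/-- The random variable `X₁`. -/
def X₁ (ω : Outcome 𝒰₁ 𝒳₁ 𝒰₂ 𝒳₂ 𝒴₁ 𝒴₂ 𝒴₃) : 𝒳₁ := ω.2.1
/-- The random variable `U₂`. -/
def U₂ (ω : Outcome 𝒰₁ 𝒳₁ 𝒰₂ 𝒳₂ 𝒴₁ 𝒴₂ 𝒴₃) : 𝒰₂ := ω.2.2.1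
/-- The random variable `X₂`. -/
def X₂ (ω : Outcome 𝒰₁ 𝒳₁ 𝒰₂ 𝒳₂ 𝒴₁ 𝒴₂ 𝒴₃) : 𝒳₂ := ω.2.2.2.1
/-- The random variable `Y₁`. -/
def Y₁ (ω : Outcome 𝒰₁ 𝒳₁ 𝒰₂ 𝒳₂ 𝒴₁ 𝒴₂ 𝒴₃) : 𝒴₁ := ω.2.2.2.2.1
/-- The random variable `Y₂`. -/
def Y₂ (ω : Outcome 𝒰₁ 𝒳₁ 𝒰₂ 𝒳₂ 𝒴₁ 𝒴₂ 𝒴₃) : 𝒴₂ := ω.2.2.2.2.2.1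
/-- The random variable `Y₃`. -/
def Y₃ (ω : Outcome 𝒰₁ 𝒳₁ 𝒰₂ 𝒳₂ 𝒴₁ 𝒴₂ 𝒴₃) : 𝒴₃ := ω.2.2.2.2.2.2

end Coordinates

section Regions

variable {𝒰₁ 𝒳₁ 𝒰₂ 𝒳₂ 𝒴₁ 𝒴₂ 𝒴₃ : Type*} [Fintype 𝒰₁] [Fintype 𝒳₁] [Fintype 𝒰₂] [Fintype 𝒳₂]
  [Fintype 𝒴₁] [Fintype 𝒴₂] [Fintype 𝒴₃]

/-- The joint probability mass function of `(U₁, X₁, U₂, X₂, Y₁, Y₂, Y₃)` when the input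
distribution `P` is used over the channel `W`. -/
def joint (W : Channel 𝒳₁ 𝒳₂ 𝒴₁ 𝒴₂ 𝒴₃) (P : InputDist 𝒰₁ 𝒳₁ 𝒰₂ 𝒳₂) :
    Outcome 𝒰₁ 𝒳₁ 𝒰₂ 𝒳₂ 𝒴₁ 𝒴₂ 𝒴₃ → ℝ :=
  fun (u₁, x₁, u₂, x₂, y₁, y₂, y₃) =>
    P.pU₁ u₁ * P.pX₁ u₁ x₁ * P.pU₂ u₂ * P.pX₂ u₂ x₂ *
      (W.W₁ x₁ y₁ * W.W₂ x₁ x₂ y₂ * W.W₃ x₂ y₃)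

/-! ### The two partial-order broadcast conditions -/

/-- The joint probability mass function `p(u₁, x₁) p(x₂) p(y₁ | x₁) p(y₂ | x₁, x₂)` of
`(U₁, X₁, X₂, Y₁, Y₂)`. -/
def broadcastJoint (W : Channel 𝒳₁ 𝒳₂ 𝒴₁ 𝒴₂ 𝒴₃)
    (p : stdSimplex ℝ (𝒰₁ × 𝒳₁)) (q : stdSimplex ℝ 𝒳₂) :
    𝒰₁ × 𝒳₁ × 𝒳₂ × 𝒴₁ × 𝒴₂ → ℝ :=
  fun (u₁, x₁, x₂, y₁, y₂) => p (u₁, x₁) * q x₂ * (W.W₁ x₁ y₁ * W.W₂ x₁ x₂ y₂)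

/-- `Y₁ ≺ₒ Y₂`: receiver 2 is interference-oblivious less noisy than receiver 1, that is,
`I(U₁; Y₁) ≤ I(U₁; Y₂)` for every finite alphabet of `U₁` and all `p(u₁, x₁) p(x₂)`. -/
def ObliviousLessNoisy (W : Channel 𝒳₁ 𝒳₂ 𝒴₁ 𝒴₂ 𝒴₃) : Prop :=
  ∀ (𝒰 : Type) [Fintype 𝒰] (p : stdSimplex ℝ (𝒰 × 𝒳₁)) (q : stdSimplex ℝ 𝒳₂),
    mutualInfo (broadcastJoint W p q) (fun (u₁, _, _, _, _) => u₁) (fun (_, _, _, y₁, _) => y₁) ≤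
      mutualInfo (broadcastJoint W p q) (fun (u₁, _, _, _, _) => u₁) (fun (_, _, _, _, y₂) => y₂)

/-- `Y₁ ≻_c Y₂`: receiver 1 is interference-cognizant less noisy than receiver 2, that is,
`I(U₁; Y₁) ≥ I(U₁; Y₂ | X₂)` for every finite alphabet of `U₁` and all `p(u₁, x₁) p(x₂)`. -/
def CognizantLessNoisy (W : Channel 𝒳₁ 𝒳₂ 𝒴₁ 𝒴₂ 𝒴₃) : Prop :=
  ∀ (𝒰 : Type) [Fintype 𝒰] (p : stdSimplex ℝ (𝒰 × 𝒳₁)) (q : stdSimplex ℝ 𝒳₂),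
    mutualInfo (broadcastJoint W p q) (fun (u₁, _, _, _, _) => u₁) (fun (_, _, _, y₁, _) => y₁) ≥
      condMutualInfo (broadcastJoint W p q) (fun (u₁, _, _, _, _) => u₁)
        (fun (_, _, _, _, y₂) => y₂) (fun (_, _, x₂, _, _) => x₂)

/-! ### The regions for a fixed input distribution -/

/-- `𝓡_{1,P}`: split messages and superposition, cloud centre for receiver 1. -/
def splitRegion₁At (W : Channel 𝒳₁ 𝒳₂ 𝒴₁ 𝒴₂ 𝒴₃) (P : InputDist 𝒰₁ 𝒳₁ 𝒰₂ 𝒳₂) :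
    Set (ℝ × ℝ × ℝ) :=
  let p := joint W P
  {(R₁, R₂, R₃) | 0 ≤ R₁ ∧ 0 ≤ R₂ ∧ 0 ≤ R₃ ∧
    R₁ ≤ mutualInfo p U₁ Y₁ ∧
    R₃ ≤ mutualInfo p X₂ Y₃ ∧
    R₁ + R₂ ≤ mutualInfo p U₁ Y₁ + condMutualInfo p X₁ Y₂ (fun ω => (U₁ ω, U₂ ω)) ∧
    R₁ + R₂ + R₃ ≤ mutualInfo p U₁ Y₁ + condMutualInfo p (fun ω => (X₁ ω, U₂ ω)) Y₂ U₁ +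
      condMutualInfo p X₂ Y₃ U₂}

/-- `𝓡_{2,P}`: split messages and superposition, cloud centre for receiver 2. -/
def splitRegion₂At (W : Channel 𝒳₁ 𝒳₂ 𝒴₁ 𝒴₂ 𝒴₃) (P : InputDist 𝒰₁ 𝒳₁ 𝒰₂ 𝒳₂) :
    Set (ℝ × ℝ × ℝ) :=
  let p := joint W P
  {(R₁, R₂, R₃) | 0 ≤ R₁ ∧ 0 ≤ R₂ ∧ 0 ≤ R₃ ∧
    R₂ ≤ condMutualInfo p U₁ Y₂ U₂ ∧
    R₃ ≤ mutualInfo p X₂ Y₃ ∧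
    R₁ + R₂ ≤ condMutualInfo p X₁ Y₁ U₁ + condMutualInfo p U₁ Y₂ U₂ ∧
    R₂ + R₃ ≤ mutualInfo p (fun ω => (U₁ ω, U₂ ω)) Y₂ + condMutualInfo p X₂ Y₃ U₂ ∧
    R₁ + R₂ + R₃ ≤ condMutualInfo p X₁ Y₁ U₁ + mutualInfo p (fun ω => (U₁ ω, U₂ ω)) Y₂ +
      condMutualInfo p X₂ Y₃ U₂}

/-- `𝓡_{(1),P}`: superposition only, the cloud centre carries receiver 1's message. -/
def superpositionRegion₁At (W : Channel 𝒳₁ 𝒳₂ 𝒴₁ 𝒴₂ 𝒴₃) (P : InputDist 𝒰₁ 𝒳₁ 𝒰₂ 𝒳₂) :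
    Set (ℝ × ℝ × ℝ) :=
  let p := joint W P
  {(R₁, R₂, R₃) | 0 ≤ R₁ ∧ 0 ≤ R₂ ∧ 0 ≤ R₃ ∧
    R₁ ≤ mutualInfo p U₁ Y₁ ∧
    R₂ ≤ condMutualInfo p X₁ Y₂ (fun ω => (U₁ ω, U₂ ω)) ∧
    R₃ ≤ mutualInfo p X₂ Y₃ ∧
    R₂ + R₃ ≤ condMutualInfo p (fun ω => (X₁ ω, U₂ ω)) Y₂ U₁ + condMutualInfo p X₂ Y₃ U₂}

/-- `𝓡_{(2),P}`: superposition only, the cloud centre carries receiver 2's message. -/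
def superpositionRegion₂At (W : Channel 𝒳₁ 𝒳₂ 𝒴₁ 𝒴₂ 𝒴₃) (P : InputDist 𝒰₁ 𝒳₁ 𝒰₂ 𝒳₂) :
    Set (ℝ × ℝ × ℝ) :=
  let p := joint W P
  {(R₁, R₂, R₃) | 0 ≤ R₁ ∧ 0 ≤ R₂ ∧ 0 ≤ R₃ ∧
    R₁ ≤ condMutualInfo p X₁ Y₁ U₁ ∧
    R₂ ≤ condMutualInfo p U₁ Y₂ U₂ ∧
    R₃ ≤ mutualInfo p X₂ Y₃ ∧
    R₂ + R₃ ≤ mutualInfo p (fun ω => (U₁ ω, U₂ ω)) Y₂ + condMutualInfo p X₂ Y₃ U₂}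

/-! ### The regions: unions over all finite auxiliary alphabets and all input distributions -/

/-- `𝓡₁ = ⋃_P 𝓡_{1,P}`. -/
def splitRegion₁ (W : Channel 𝒳₁ 𝒳₂ 𝒴₁ 𝒴₂ 𝒴₃) : Set (ℝ × ℝ × ℝ) :=
  {R | ∃ (𝒰₁ 𝒰₂ : Type) (_ : Fintype 𝒰₁) (_ : Fintype 𝒰₂) (P : InputDist 𝒰₁ 𝒳₁ 𝒰₂ 𝒳₂),
    R ∈ splitRegion₁At W P}

/-- `𝓡₂ = ⋃_P 𝓡_{2,P}`. -/
def splitRegion₂ (W : Channel 𝒳₁ 𝒳₂ 𝒴₁ 𝒴₂ 𝒴₃) : Set (ℝ × ℝ × ℝ) :=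
  {R | ∃ (𝒰₁ 𝒰₂ : Type) (_ : Fintype 𝒰₁) (_ : Fintype 𝒰₂) (P : InputDist 𝒰₁ 𝒳₁ 𝒰₂ 𝒳₂),
    R ∈ splitRegion₂At W P}

/-- `𝓡₍₁₎ = ⋃_P 𝓡_{(1),P}`. -/
def superpositionRegion₁ (W : Channel 𝒳₁ 𝒳₂ 𝒴₁ 𝒴₂ 𝒴₃) : Set (ℝ × ℝ × ℝ) :=
  {R | ∃ (𝒰₁ 𝒰₂ : Type) (_ : Fintype 𝒰₁) (_ : Fintype 𝒰₂) (P : InputDist 𝒰₁ 𝒳₁ 𝒰₂ 𝒳₂),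
    R ∈ superpositionRegion₁At W P}

/-- `𝓡₍₂₎ = ⋃_P 𝓡_{(2),P}`. -/
def superpositionRegion₂ (W : Channel 𝒳₁ 𝒳₂ 𝒴₁ 𝒴₂ 𝒴₃) : Set (ℝ × ℝ × ℝ) :=
  {R | ∃ (𝒰₁ 𝒰₂ : Type) (_ : Fintype 𝒰₁) (_ : Fintype 𝒰₂) (P : InputDist 𝒰₁ 𝒳₁ 𝒰₂ 𝒳₂),
    R ∈ superpositionRegion₂At W P}

end Regions

end BIC

end

noncomputable section

namespace BIC

/-! ### Entropy, submodularity and conditional independence -/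

section Entropy

variable {Ω α β γ : Type*} [Fintype Ω] [Fintype α] [Fintype β] [Fintype γ]

/-! Superposition regions lie in split regions for the same `P`, by adding inequalities. For the
converse, rate must be moved between receivers 1 and 2, and this is done by weakening the cloud
centre: `U₁` is replaced by its erasure, kept with probability `l` and otherwise set to `none`, with
`X₁` then drawn from its marginal.

Erasure multiplies I(U₁;Y₁), I(U₁;Y₂) and I(U₁;Y₂|U₂) by `l` and leaves the law of all other
variables unchanged. Since U₁ → X₁ → Y₁ and U₁ → (X₁,U₂) → Y₂ are Markov chains, the chain rule
shows that I(X₁;Y₂|U₁,U₂), I(X₁,U₂;Y₂|U₁) and I(X₁;Y₁|U₁) gain exactly the information that `U₁`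
loses: (1-l) times I(U₁;Y₂|U₂), I(U₁;Y₂) and I(U₁;Y₁) respectively.

The order hypothesis makes the trade favourable. In the oblivious case I(U₁;Y₁) ≤ I(U₁;Y₂) ≤
I(U₁;Y₂|U₂), so what receiver 1 gives up is at most what receiver 2 gains. In the cognizant case
I(U₁;Y₂|U₂) ≤ I(U₁;Y₂|X₂) ≤ I(U₁;Y₁), so the reverse trade works. It remains to choose `l` so that
exactly the required rate moves. -/

omit [Fintype α] in
theorem law_nonneg {p : Ω → ℝ} (hp : ∀ ω, 0 ≤ p ω) (X : Ω → α) (a : α) : 0 ≤ law p X a :=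
  Finset.sum_nonneg fun ω _ => by split_ifs <;> simp [hp ω]

theorem sum_law (p : Ω → ℝ) (X : Ω → α) : ∑ a, law p X a = ∑ ω, p ω := by
  classical
  unfold law
  rw [Finset.sum_comm]
  simp

omit [Fintype β] in
/-- The law of a function of `X` is computed from the law of `X`. -/
theorem law_comp (p : Ω → ℝ) (X : Ω → α) (f : α → β) (b : β) :
    law p (fun ω => f (X ω)) b = law (law p X) f b := by
  classical
  unfold law
  have h : ∀ a, (if f a = b then ∑ ω, (if X ω = a then p ω else 0) else 0) =
      ∑ ω, if X ω = a then (if f a = b then p ω else 0) else 0 := fun a => by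
    split_ifs <;> simp
  simp only [h]
  rw [Finset.sum_comm]
  simp

/-- The law of the identity. -/
theorem law_id (p : Ω → ℝ) (t : Ω) : law p (fun t => t) t = p t := by
  classical
  simp [law]

theorem entropy_comp (p : Ω → ℝ) (X : Ω → α) (f : α → β) :
    entropy p (fun ω => f (X ω)) = entropy (law p X) f := by
  simp only [entropy, law_comp]

omit [Fintype α] [Fintype β] in
theorem law_equiv (p : Ω → ℝ) {X : Ω → α} {Y : Ω → β} (e : α ≃ β) (h : ∀ ω, e (X ω) = Y ω)
    (a : α) : law p X a = law p Y (e a) := by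
  classical
  unfold law
  refine Finset.sum_congr rfl fun ω _ => if_congr ?_ rfl rfl
  rw [← h, e.apply_eq_iff_eq]

theorem entropy_equiv (p : Ω → ℝ) {X : Ω → α} {Y : Ω → β} (e : α ≃ β) (h : ∀ ω, e (X ω) = Y ω) :
    entropy p X = entropy p Y := by
  simp only [entropy, law_equiv p e h]
  exact e.sum_comp (fun b => Real.negMulLog (law p Y b) / Real.log 2)

theorem entropy_swap (p : Ω → ℝ) (X : Ω → α) (Y : Ω → β) :
    entropy p (fun ω => (X ω, Y ω)) = entropy p (fun ω => (Y ω, X ω)) :=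
  entropy_equiv p (Equiv.prodComm α β) fun _ => rfl

theorem entropy_left_comm (p : Ω → ℝ) (X : Ω → α) (Y : Ω → β) (Z : Ω → γ) :
    entropy p (fun ω => (X ω, Y ω, Z ω)) = entropy p (fun ω => (Y ω, X ω, Z ω)) :=
  entropy_equiv p ⟨fun (a, b, c) => (b, a, c), fun (b, a, c) => (a, b, c), fun _ => rfl,
    fun _ => rfl⟩ fun _ => rfl

/-- Entropy as an expectation over the whole space. -/
theorem entropy_eq_sum (p : Ω → ℝ) (X : Ω → α) :
    entropy p X = ∑ ω, p ω * (-Real.log (law p X (X ω))) / Real.log 2 := by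
  classical
  unfold entropy
  have : ∀ a, Real.negMulLog (law p X a) / Real.log 2 =
      ∑ ω, if X ω = a then p ω * (-Real.log (law p X a)) / Real.log 2 else 0 := fun a => by
    rw [Real.negMulLog]
    conv_lhs => enter [1, 1, 1]; unfold law
    rw [neg_mul, Finset.sum_mul, ← Finset.sum_neg_distrib, Finset.sum_div]
    refine Finset.sum_congr rfl fun ω _ => ?_
    split_ifs <;> simp
  simp only [this]
  rw [Finset.sum_comm]
  simp

-- At an outcome of positive mass every marginal is positive, so logarithms of marginals may be
-- split there.
omit [Fintype α] in
theorem le_law {p : Ω → ℝ} (hp : ∀ ω, 0 ≤ p ω) (X : Ω → α) (ω : Ω) : p ω ≤ law p X (X ω) := by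
  classical
  unfold law
  refine le_trans ?_ (Finset.single_le_sum (f := fun ω' => if X ω' = X ω then p ω' else 0)
    (fun ω' _ => ?_) (Finset.mem_univ ω))
  · simp
  · split_ifs <;> simp [hp]

theorem law_fst_thd (p : α × β × γ → ℝ) (a : α) (c : γ) :
    law p (fun t => (t.1, t.2.2)) (a, c) = ∑ b, p (a, b, c) := by
  classical
  simp [law, Fintype.sum_prod_type, ite_and, Finset.sum_ite_irrel]

theorem law_snd (p : α × β → ℝ) (b : β) : law p (fun t => t.2) b = ∑ a, p (a, b) := by
  classical
  simp [law, Fintype.sum_prod_type]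

theorem law_thd (p : α × β × γ → ℝ) (c : γ) :
    law p (fun t => t.2.2) c = ∑ a, ∑ b, p (a, b, c) := by
  classical
  simp [law, Fintype.sum_prod_type]

/-- Gibbs' inequality: log x ≤ x - 1 at x = AB/(pC), averaged over `p`. The function AB/C has the
same total mass as `p`, so the right-hand side sums to zero. -/
theorem entropy_submodular_coord {p : α × β × γ → ℝ} (hp : ∀ t, 0 ≤ p t) :
    entropy p (fun t => t) + entropy p (fun t => t.2.2) ≤
      entropy p (fun t => (t.1, t.2.2)) + entropy p (fun t => t.2) := by
  classical
  have hlog : 0 < Real.log 2 := Real.log_pos one_lt_two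
  set A := law p (fun t : α × β × γ => (t.1, t.2.2))
  set B := law p (fun t : α × β × γ => t.2)
  set C := law p (fun t : α × β × γ => t.2.2)
  have hA0 : ∀ x, 0 ≤ A x := law_nonneg hp _
  have hB0 : ∀ x, 0 ≤ B x := law_nonneg hp _
  have hC0 : ∀ x, 0 ≤ C x := law_nonneg hp _
  have key : ∀ t : α × β × γ, p t * (Real.log (A (t.1, t.2.2)) + Real.log (B t.2)
      - Real.log (p t) - Real.log (C t.2.2)) ≤ A (t.1, t.2.2) * B t.2 / C t.2.2 - p t := by
    intro t
    rcases (hp t).eq_or_lt with h | h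
    · rw [← h]
      simpa using div_nonneg (mul_nonneg (hA0 _) (hB0 _)) (hC0 _)
    · have hA : 0 < A (t.1, t.2.2) := h.trans_le (le_law hp (fun t => (t.1, t.2.2)) t)
      have hB : 0 < B t.2 := h.trans_le (le_law hp (fun t => t.2) t)
      have hC : 0 < C t.2.2 := h.trans_le (le_law hp (fun t => t.2.2) t)
      have h1 := Real.log_le_sub_one_of_pos
        (show 0 < A (t.1, t.2.2) * B t.2 / (p t * C t.2.2) by positivity)
      rw [Real.log_div (by positivity) (by positivity), Real.log_mul hA.ne' hB.ne',
        Real.log_mul h.ne' hC.ne'] at h1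
      have h2 := mul_le_mul_of_nonneg_left h1 h.le
      calc _ = p t * (Real.log (A (t.1, t.2.2)) + Real.log (B t.2)
            - (Real.log (p t) + Real.log (C t.2.2))) := by ring
        _ ≤ _ := h2
        _ = _ := by field_simp
  have hsum : ∑ t : α × β × γ, A (t.1, t.2.2) * B t.2 / C t.2.2 = ∑ t, p t := by
    have hAC : ∀ c, ∑ a, A (a, c) = C c := fun c => by
      simp only [A, C, law_fst_thd, law_thd]
    have hBC : ∀ c, ∑ b, B (b, c) = C c := fun c => by
      simp only [B, C, law_snd, law_thd]
      exact Finset.sum_comm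
    calc ∑ t : α × β × γ, A (t.1, t.2.2) * B t.2 / C t.2.2
        = ∑ c, (∑ a, A (a, c)) * (∑ b, B (b, c)) / C c := by
          simp only [Fintype.sum_prod_type, Finset.sum_mul_sum, Finset.sum_div]
          rw [Finset.sum_congr rfl (fun a _ => Finset.sum_comm), Finset.sum_comm]
      _ = ∑ c, C c := Finset.sum_congr rfl fun c _ => by
          rw [hAC, hBC]
          -- Where `C c` vanishes, division by zero gives 0, which is again `C c`.
          rcases eq_or_ne (C c) 0 with h | h
          · simp [h]
          · field_simp
      _ = _ := sum_law _ _
  have hfin := Finset.sum_le_sum fun t (_ : t ∈ Finset.univ) => key t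
  rw [Finset.sum_sub_distrib, hsum, sub_self] at hfin
  simp only [entropy_eq_sum p, law_id, ← Finset.sum_add_distrib]
  rw [← sub_nonpos, ← Finset.sum_sub_distrib]
  calc _ = (∑ t : α × β × γ, p t * (Real.log (A (t.1, t.2.2)) + Real.log (B t.2)
      - Real.log (p t) - Real.log (C t.2.2))) / Real.log 2 := by
        rw [Finset.sum_div]
        exact Finset.sum_congr rfl fun t _ => by ring
    _ ≤ 0 := div_nonpos_of_nonpos_of_nonneg hfin hlog.le

/-- Conditional independence of the first two coordinates given the third one. -/
theorem entropy_factor_coord {p : α × β × γ → ℝ} (hp : ∀ t, 0 ≤ p t) {f : α → γ → ℝ}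
    {g : β → γ → ℝ} (h : ∀ a b c, p (a, b, c) = f a c * g b c) :
    entropy p (fun t => t) + entropy p (fun t => t.2.2) =
      entropy p (fun t => (t.1, t.2.2)) + entropy p (fun t => t.2) := by
  classical
  simp only [entropy_eq_sum p, law_id, ← Finset.sum_add_distrib]
  refine Finset.sum_congr rfl fun t _ => ?_
  rcases (hp t).eq_or_lt with h0 | h0
  · simp [← h0]
  have hA := h0.trans_le (le_law hp (fun t => (t.1, t.2.2)) t)
  have hB := h0.trans_le (le_law hp (fun t => t.2) t)
  have hC := h0.trans_le (le_law hp (fun t => t.2.2) t)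
  -- Both sides equal f(a,c) g(b,c) (∑ f)(∑ g); its logarithm is the identity wanted at each
  -- outcome.
  have hmul : p t * law p (fun t => t.2.2) t.2.2 =
      law p (fun t => (t.1, t.2.2)) (t.1, t.2.2) * law p (fun t => t.2) t.2 := by
    obtain ⟨a, b, c⟩ := t
    simp only [law_fst_thd, law_snd, law_thd, h, ← Finset.mul_sum, ← Finset.sum_mul]
    ring
  have hlog := congrArg Real.log hmul
  rw [Real.log_mul h0.ne' hC.ne', Real.log_mul hA.ne' hB.ne'] at hlog
  linear_combination (-p t / Real.log 2) * hlog

/-- Submodularity of entropy: `H(X, Y, Z) + H(Z) ≤ H(X, Z) + H(Y, Z)`. -/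
theorem entropy_submodular {p : Ω → ℝ} (hp : ∀ ω, 0 ≤ p ω) (X : Ω → α) (Y : Ω → β) (Z : Ω → γ) :
    entropy p (fun ω => (X ω, Y ω, Z ω)) + entropy p Z ≤
      entropy p (fun ω => (X ω, Z ω)) + entropy p (fun ω => (Y ω, Z ω)) := by
  have h := entropy_submodular_coord (law_nonneg hp fun ω => (X ω, Y ω, Z ω))
  simpa only [← entropy_comp] using h

/-- `H(X, Y, Z) + H(Z) = H(X, Z) + H(Y, Z)` when `X → Z → Y` is a Markov chain. -/
theorem entropy_factor {p : Ω → ℝ} (hp : ∀ ω, 0 ≤ p ω) (X : Ω → α) (Y : Ω → β) (Z : Ω → γ)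
    (f : α → γ → ℝ) (g : β → γ → ℝ)
    (h : ∀ a b c, law p (fun ω => (X ω, Y ω, Z ω)) (a, b, c) = f a c * g b c) :
    entropy p (fun ω => (X ω, Y ω, Z ω)) + entropy p Z =
      entropy p (fun ω => (X ω, Z ω)) + entropy p (fun ω => (Y ω, Z ω)) := by
  have h := entropy_factor_coord (law_nonneg hp fun ω => (X ω, Y ω, Z ω)) h
  simpa only [← entropy_comp] using h

theorem entropy_unit {p : Ω → ℝ} (hp : ∑ ω, p ω = 1) : entropy p (fun _ => ()) = 0 := by
  simp [entropy, law, hp]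

/-- `H(X, Y) = H(X) + H(Y)` for independent `X` and `Y`. -/
theorem entropy_indep {p : Ω → ℝ} (hp : ∀ ω, 0 ≤ p ω) (hp1 : ∑ ω, p ω = 1)
    (X : Ω → α) (Y : Ω → β) (f : α → ℝ) (g : β → ℝ)
    (h : ∀ a b, law p (fun ω => (X ω, Y ω)) (a, b) = f a * g b) :
    entropy p (fun ω => (X ω, Y ω)) = entropy p X + entropy p Y := by
  let e : α × β × Unit ≃ α × β :=
    ⟨fun (a, b, _) => (a, b), fun (a, b) => (a, b, ()), fun _ => rfl, fun _ => rfl⟩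
  -- Independence is conditional independence given a constant.
  have hf := entropy_factor hp X Y (fun _ => ()) (fun a _ => f a) (fun b _ => g b)
    (fun a b c => (law_equiv p e (fun _ => rfl) (a, b, c)).trans (h a b))
  rw [entropy_unit hp1] at hf
  have h1 : entropy p (fun ω => (X ω, Y ω, ())) = entropy p (fun ω => (X ω, Y ω)) :=
    entropy_equiv p e fun _ => rfl
  have h2 : entropy p (fun ω => (X ω, ())) = entropy p X :=
    entropy_equiv p (Equiv.prodPUnit α) fun _ => rfl
  have h3 : entropy p (fun ω => (Y ω, ())) = entropy p Y :=
    entropy_equiv p (Equiv.prodPUnit β) fun _ => rfl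
  linarith

end Entropy

/-! ### Erasing one coordinate of a joint law -/

section Erasure

variable {𝒰 Ω α β γ : Type*} [Fintype 𝒰] [Fintype Ω] [Fintype α] [Fintype β] [Fintype γ]

/-- The first coordinate is erased (replaced by `none`) with probability `1 - l`, independently
of everything else. -/
def erase (l : ℝ) (p : 𝒰 × Ω → ℝ) : Option 𝒰 × Ω → ℝ
  | (some u, ω) => l * p (u, ω)
  | (none, ω) => (1 - l) * ∑ u, p (u, ω)

omit [Fintype α] in
theorem law_erase (l : ℝ) (p : 𝒰 × Ω → ℝ) (Z : Ω → α) (a : α) :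
    law (erase l p) (fun t => Z t.2) a = law p (fun t => Z t.2) a := by
  classical
  simp only [law, Fintype.sum_prod_type, Fintype.sum_option, erase]
  rw [Finset.sum_comm (s := (Finset.univ : Finset 𝒰)),
    Finset.sum_comm (s := (Finset.univ : Finset 𝒰)), ← Finset.sum_add_distrib]
  refine Finset.sum_congr rfl fun ω _ => ?_
  split_ifs
  · rw [← Finset.mul_sum]; ring
  · simp

omit [Fintype α] in
theorem law_erase_some (l : ℝ) (p : 𝒰 × Ω → ℝ) (Z : Ω → α) (u : 𝒰) (a : α) :
    law (erase l p) (fun t => (t.1, Z t.2)) (some u, a) =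
      l * law p (fun t => (t.1, Z t.2)) (u, a) := by
  classical
  simp [law, Fintype.sum_prod_type, erase, ite_and, Finset.mul_sum,
    Finset.sum_ite_irrel]

omit [Fintype α] in
theorem law_erase_none (l : ℝ) (p : 𝒰 × Ω → ℝ) (Z : Ω → α) (a : α) :
    law (erase l p) (fun t => (t.1, Z t.2)) (none, a) = (1 - l) * law p (fun t => Z t.2) a := by
  classical
  simp only [law, Fintype.sum_prod_type, Fintype.sum_option, erase]
  rw [Finset.sum_comm (s := (Finset.univ : Finset 𝒰)),
    Finset.sum_comm (s := (Finset.univ : Finset 𝒰)), Finset.mul_sum]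
  simp only [Prod.mk.injEq, true_and, reduceCtorEq, false_and, if_false, Finset.sum_const_zero,
    add_zero]
  refine Finset.sum_congr rfl fun ω _ => ?_
  split_ifs <;> simp

theorem entropy_erase (l : ℝ) (p : 𝒰 × Ω → ℝ) (Z : Ω → α) :
    entropy (erase l p) (fun t => Z t.2) = entropy p (fun t => Z t.2) := by
  simp only [entropy, law_erase]

/-- The erasure flag can be read off the first coordinate, so the entropy is that of the flag plus
the average over its two values. The flag term cancels in every mutual information below. -/
theorem entropy_erase_pair (l : ℝ) {p : 𝒰 × Ω → ℝ} (hp : ∑ t, p t = 1) (Z : Ω → α) :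
    entropy (erase l p) (fun t => (t.1, Z t.2)) =
      l * entropy p (fun t => (t.1, Z t.2)) + (1 - l) * entropy p (fun t => Z t.2) +
        (Real.negMulLog l + Real.negMulLog (1 - l)) / Real.log 2 := by
  have h1 := sum_law p (fun t => (t.1, Z t.2))
  have h2 := sum_law p (fun t => Z t.2)
  rw [hp] at h1 h2
  rw [Fintype.sum_prod_type] at h1
  simp only [entropy, Fintype.sum_prod_type, Fintype.sum_option, law_erase_some, law_erase_none,
    Real.negMulLog_mul, ← Finset.sum_div, Finset.sum_add_distrib, ← Finset.mul_sum,
    ← Finset.sum_mul, h1, h2]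
  ring

theorem entropy_erase_fst (l : ℝ) {p : 𝒰 × Ω → ℝ} (hp : ∑ t, p t = 1) :
    entropy (erase l p) (fun t => t.1) =
      l * entropy p (fun t => t.1) +
        (Real.negMulLog l + Real.negMulLog (1 - l)) / Real.log 2 := by
  -- With a constant second variable the pair has the entropy of its first coordinate.
  have h := entropy_erase_pair l hp (fun _ => ())
  rw [entropy_unit hp] at h
  have h1 : ∀ {β : Type _} [Fintype β] (q : β × Ω → ℝ),
      entropy q (fun t => (t.1, ())) = entropy q (fun t => t.1) := fun q =>
    entropy_equiv q (Equiv.prodPUnit _) fun _ => rfl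
  rw [h1, h1] at h
  linarith

theorem mutualInfo_erase (l : ℝ) (p : 𝒰 × Ω → ℝ) (X : Ω → α) (Y : Ω → β) :
    mutualInfo (erase l p) (fun t => X t.2) (fun t => Y t.2) =
      mutualInfo p (fun t => X t.2) (fun t => Y t.2) := by
  simp only [mutualInfo, condEntropy, entropy_erase l p X, entropy_erase l p Y,
    entropy_erase l p fun t => (X t, Y t)]

theorem condMutualInfo_erase (l : ℝ) (p : 𝒰 × Ω → ℝ) (X : Ω → α) (Y : Ω → β) (Z : Ω → γ) :
    condMutualInfo (erase l p) (fun t => X t.2) (fun t => Y t.2) (fun t => Z t.2) =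
      condMutualInfo p (fun t => X t.2) (fun t => Y t.2) (fun t => Z t.2) := by
  simp only [condMutualInfo, condEntropy, entropy_erase l p Z,
    entropy_erase l p fun t => (X t, Z t), entropy_erase l p fun t => (Y t, Z t),
    entropy_erase l p fun t => (X t, Y t, Z t)]

theorem mutualInfo_erase_fst (l : ℝ) {p : 𝒰 × Ω → ℝ} (hp : ∑ t, p t = 1) (Y : Ω → β) :
    mutualInfo (erase l p) (fun t => t.1) (fun t => Y t.2) =
      l * mutualInfo p (fun t => t.1) (fun t => Y t.2) := by
  simp only [mutualInfo, condEntropy, entropy_erase l p Y, entropy_erase_fst l hp,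
    entropy_erase_pair l hp Y]
  ring

theorem condMutualInfo_erase_fst (l : ℝ) {p : 𝒰 × Ω → ℝ} (hp : ∑ t, p t = 1) (Y : Ω → β)
    (Z : Ω → γ) :
    condMutualInfo (erase l p) (fun t => t.1) (fun t => Y t.2) (fun t => Z t.2) =
      l * condMutualInfo p (fun t => t.1) (fun t => Y t.2) (fun t => Z t.2) := by
  simp only [condMutualInfo, condEntropy, entropy_erase l p Z, entropy_erase_pair l hp Z,
    entropy_erase l p fun t => (Y t, Z t), entropy_erase_pair l hp fun t => (Y t, Z t)]
  ring

end Erasure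

/-! ### Independence, Markov chains and chain rules for the channel -/

section Channel

variable {𝒰₁ 𝒳₁ 𝒰₂ 𝒳₂ 𝒴₁ 𝒴₂ 𝒴₃ : Type*} [Fintype 𝒰₁] [Fintype 𝒳₁] [Fintype 𝒰₂] [Fintype 𝒳₂]
  [Fintype 𝒴₁] [Fintype 𝒴₂] [Fintype 𝒴₃]

theorem joint_nonneg (W : Channel 𝒳₁ 𝒳₂ 𝒴₁ 𝒴₂ 𝒴₃) (P : InputDist 𝒰₁ 𝒳₁ 𝒰₂ 𝒳₂) (ω) :
    0 ≤ joint W P ω := by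
  obtain ⟨u₁, x₁, u₂, x₂, y₁, y₂, y₃⟩ := ω
  simp only [joint]
  have h1 := P.pU₁.2.1 u₁
  have h2 := (P.pX₁ u₁).2.1 x₁
  have h3 := P.pU₂.2.1 u₂
  have h4 := (P.pX₂ u₂).2.1 x₂
  have h5 := (W.W₁ x₁).2.1 y₁
  have h6 := (W.W₂ x₁ x₂).2.1 y₂
  have h7 := (W.W₃ x₂).2.1 y₃
  exact mul_nonneg (mul_nonneg (mul_nonneg (mul_nonneg h1 h2) h3) h4)
    (mul_nonneg (mul_nonneg h5 h6) h7)

theorem sum_joint (W : Channel 𝒳₁ 𝒳₂ 𝒴₁ 𝒴₂ 𝒴₃) (P : InputDist 𝒰₁ 𝒳₁ 𝒰₂ 𝒳₂) :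
    ∑ ω, joint W P ω = 1 := by
  simp [joint, Fintype.sum_prod_type, ← Finset.mul_sum]

/-- The marginal law `p(u₁, x₁)`. -/
def InputDist.marginal₁ (P : InputDist 𝒰₁ 𝒳₁ 𝒰₂ 𝒳₂) : stdSimplex ℝ (𝒰₁ × 𝒳₁) :=
  ⟨fun t => P.pU₁ t.1 * P.pX₁ t.1 t.2,
    fun t => mul_nonneg (P.pU₁.2.1 t.1) ((P.pX₁ t.1).2.1 t.2),
    by simp [Fintype.sum_prod_type, ← Finset.mul_sum]⟩

/-- The law of the channel input obtained by averaging `p(x | u)` over `p(u)`. -/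
def mixture {𝒰 𝒳 : Type*} [Fintype 𝒰] [Fintype 𝒳] (p : stdSimplex ℝ 𝒰)
    (k : 𝒰 → stdSimplex ℝ 𝒳) : stdSimplex ℝ 𝒳 :=
  ⟨fun x => ∑ u, p u * k u x,
    fun x => Finset.sum_nonneg fun u _ => mul_nonneg (p.2.1 u) ((k u).2.1 x), by
    rw [Finset.sum_comm]
    simp [← Finset.mul_sum]⟩

/-- The order conditions speak of `broadcastJoint`; this lets them be applied to any `P`, with `U₂`
averaged out. -/
theorem law_broadcast (W : Channel 𝒳₁ 𝒳₂ 𝒴₁ 𝒴₂ 𝒴₃) (P : InputDist 𝒰₁ 𝒳₁ 𝒰₂ 𝒳₂) :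
    law (joint W P) (fun ω => (U₁ ω, X₁ ω, X₂ ω, Y₁ ω, Y₂ ω)) =
      broadcastJoint W P.marginal₁ (mixture P.pU₂ P.pX₂) := by
  classical
  ext ⟨u₁, x₁, x₂, y₁, y₂⟩
  have h1 : P.marginal₁ (u₁, x₁) = P.pU₁ u₁ * P.pX₁ u₁ x₁ := rfl
  have h2 : mixture P.pU₂ P.pX₂ x₂ = ∑ u₂, P.pU₂ u₂ * P.pX₂ u₂ x₂ := rfl
  simp only [broadcastJoint, h1, h2]
  simp [law, joint, U₁, X₁, X₂, Y₁, Y₂, Fintype.sum_prod_type, ite_and,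
    Finset.sum_ite_irrel, ← Finset.mul_sum]
  rw [Finset.mul_sum, Finset.sum_mul]
  exact Finset.sum_congr rfl fun _ _ => by ring

theorem law_U₁_Y₂_X₁_U₂ (W : Channel 𝒳₁ 𝒳₂ 𝒴₁ 𝒴₂ 𝒴₃) (P : InputDist 𝒰₁ 𝒳₁ 𝒰₂ 𝒳₂) (u₁ y₂)
    (c : 𝒳₁ × 𝒰₂) :
    law (joint W P) (fun ω => (U₁ ω, Y₂ ω, X₁ ω, U₂ ω)) (u₁, y₂, c) =
      (P.pU₁ u₁ * P.pX₁ u₁ c.1) * ∑ x₂, P.pU₂ c.2 * P.pX₂ c.2 x₂ * W.W₂ c.1 x₂ y₂ := by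
  classical
  obtain ⟨x₁, u₂⟩ := c
  simp [law, joint, U₁, X₁, U₂, Y₂, Fintype.sum_prod_type, ite_and,
    Finset.sum_ite_irrel, ← Finset.mul_sum, ← Finset.sum_mul]
  rw [Finset.mul_sum]
  exact Finset.sum_congr rfl fun _ _ => by ring

theorem law_U₁_Y₁_X₁ (W : Channel 𝒳₁ 𝒳₂ 𝒴₁ 𝒴₂ 𝒴₃) (P : InputDist 𝒰₁ 𝒳₁ 𝒰₂ 𝒳₂) (u₁ y₁ x₁) :
    law (joint W P) (fun ω => (U₁ ω, Y₁ ω, X₁ ω)) (u₁, y₁, x₁) =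
      (P.pU₁ u₁ * P.pX₁ u₁ x₁) * W.W₁ x₁ y₁ := by
  classical
  simp [law, joint, U₁, X₁, Y₁, Fintype.sum_prod_type, ite_and,
    Finset.sum_ite_irrel, ← Finset.mul_sum, ← Finset.sum_mul]

/-- The product form says that `U₁` and `U₂` are conditionally independent given (Y₂,X₂): `U₂`
enters only through its joint law with `X₂`. -/
theorem law_U₂_U₁_X₂_Y₂ (W : Channel 𝒳₁ 𝒳₂ 𝒴₁ 𝒴₂ 𝒴₃) (P : InputDist 𝒰₁ 𝒳₁ 𝒰₂ 𝒳₂) (u₂ u₁)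
    (c : 𝒴₂ × 𝒳₂) :
    law (joint W P) (fun ω => (U₂ ω, U₁ ω, Y₂ ω, X₂ ω)) (u₂, u₁, c) =
      (P.pU₂ u₂ * P.pX₂ u₂ c.2) * ∑ x₁, P.pU₁ u₁ * P.pX₁ u₁ x₁ * W.W₂ x₁ c.2 c.1 := by
  classical
  obtain ⟨y₂, x₂⟩ := c
  simp [law, joint, U₁, X₂, U₂, Y₂, Fintype.sum_prod_type, ite_and,
    Finset.sum_ite_irrel, ← Finset.mul_sum, ← Finset.sum_mul]
  rw [Finset.mul_sum]
  exact Finset.sum_congr rfl fun _ _ => by ring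

theorem law_U₁_U₂ (W : Channel 𝒳₁ 𝒳₂ 𝒴₁ 𝒴₂ 𝒴₃) (P : InputDist 𝒰₁ 𝒳₁ 𝒰₂ 𝒳₂) (u₁ u₂) :
    law (joint W P) (fun ω => (U₁ ω, U₂ ω)) (u₁, u₂) = P.pU₁ u₁ * P.pU₂ u₂ := by
  classical
  simp [law, joint, U₁, U₂, Fintype.sum_prod_type, ite_and,
    Finset.sum_ite_irrel, ← Finset.mul_sum, ← Finset.sum_mul]

theorem law_U₁_X₂ (W : Channel 𝒳₁ 𝒳₂ 𝒴₁ 𝒴₂ 𝒴₃) (P : InputDist 𝒰₁ 𝒳₁ 𝒰₂ 𝒳₂) (u₁ x₂) :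
    law (joint W P) (fun ω => (U₁ ω, X₂ ω)) (u₁, x₂) =
      P.pU₁ u₁ * ∑ u₂, P.pU₂ u₂ * P.pX₂ u₂ x₂ := by
  classical
  simp [law, joint, U₁, X₂, Fintype.sum_prod_type, ite_and,
    Finset.sum_ite_irrel, ← Finset.mul_sum]
  rw [Finset.sum_comm, Finset.mul_sum]
  refine Finset.sum_congr rfl fun _ _ => ?_
  rw [← Finset.sum_mul, ← Finset.sum_mul, ← Finset.mul_sum, stdSimplex.sum_eq_one]
  ring

/-- `H(Y₂ | U₁, X₁, U₂) = H(Y₂ | X₁, U₂)`. -/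
theorem markov_U₁_Y₂ (W : Channel 𝒳₁ 𝒳₂ 𝒴₁ 𝒴₂ 𝒴₃) (P : InputDist 𝒰₁ 𝒳₁ 𝒰₂ 𝒳₂) :
    entropy (joint W P) (fun ω => (U₁ ω, Y₂ ω, X₁ ω, U₂ ω)) +
        entropy (joint W P) (fun ω => (X₁ ω, U₂ ω)) =
      entropy (joint W P) (fun ω => (U₁ ω, X₁ ω, U₂ ω)) +
        entropy (joint W P) (fun ω => (Y₂ ω, X₁ ω, U₂ ω)) :=
  entropy_factor (joint_nonneg W P) U₁ Y₂ (fun ω => (X₁ ω, U₂ ω))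
    (fun u₁ c => P.pU₁ u₁ * P.pX₁ u₁ c.1)
    (fun y₂ c => ∑ x₂, P.pU₂ c.2 * P.pX₂ c.2 x₂ * W.W₂ c.1 x₂ y₂) (law_U₁_Y₂_X₁_U₂ W P)

/-- `H(Y₁ | U₁, X₁) = H(Y₁ | X₁)`. -/
theorem markov_U₁_Y₁ (W : Channel 𝒳₁ 𝒳₂ 𝒴₁ 𝒴₂ 𝒴₃) (P : InputDist 𝒰₁ 𝒳₁ 𝒰₂ 𝒳₂) :
    entropy (joint W P) (fun ω => (U₁ ω, Y₁ ω, X₁ ω)) + entropy (joint W P) X₁ =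
      entropy (joint W P) (fun ω => (U₁ ω, X₁ ω)) + entropy (joint W P) (fun ω => (Y₁ ω, X₁ ω)) :=
  entropy_factor (joint_nonneg W P) U₁ Y₁ X₁ (fun u₁ x₁ => P.pU₁ u₁ * P.pX₁ u₁ x₁)
    (fun y₁ x₁ => W.W₁ x₁ y₁) (law_U₁_Y₁_X₁ W P)

theorem entropy_U₁_U₂ (W : Channel 𝒳₁ 𝒳₂ 𝒴₁ 𝒴₂ 𝒴₃) (P : InputDist 𝒰₁ 𝒳₁ 𝒰₂ 𝒳₂) :
    entropy (joint W P) (fun ω => (U₁ ω, U₂ ω)) =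
      entropy (joint W P) U₁ + entropy (joint W P) U₂ :=
  entropy_indep (joint_nonneg W P) (sum_joint W P) U₁ U₂ P.pU₁ P.pU₂ (law_U₁_U₂ W P)

theorem entropy_U₁_X₂ (W : Channel 𝒳₁ 𝒳₂ 𝒴₁ 𝒴₂ 𝒴₃) (P : InputDist 𝒰₁ 𝒳₁ 𝒰₂ 𝒳₂) :
    entropy (joint W P) (fun ω => (U₁ ω, X₂ ω)) =
      entropy (joint W P) U₁ + entropy (joint W P) X₂ :=
  entropy_indep (joint_nonneg W P) (sum_joint W P) U₁ X₂ P.pU₁ _ (law_U₁_X₂ W P)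

/-- `I(U₁; Y₂) ≤ I(U₁; Y₂ | U₂)`. -/
theorem mutualInfo_U₁_Y₂_le (W : Channel 𝒳₁ 𝒳₂ 𝒴₁ 𝒴₂ 𝒴₃) (P : InputDist 𝒰₁ 𝒳₁ 𝒰₂ 𝒳₂) :
    mutualInfo (joint W P) U₁ Y₂ ≤ condMutualInfo (joint W P) U₁ Y₂ U₂ := by
  have h1 := entropy_U₁_U₂ W P
  -- As `U₁` and `U₂` are independent, the difference of the two sides is I(U₁;U₂|Y₂) ≥ 0.
  have h2 := entropy_submodular (joint_nonneg W P) U₁ U₂ Y₂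
  have h3 : entropy (joint W P) (fun ω => (U₁ ω, U₂ ω, Y₂ ω)) =
      entropy (joint W P) (fun ω => (U₁ ω, Y₂ ω, U₂ ω)) :=
    entropy_equiv _ ⟨fun (a, b, c) => (a, c, b), fun (a, c, b) => (a, b, c), fun _ => rfl,
      fun _ => rfl⟩ fun _ => rfl
  have h4 := entropy_swap (joint W P) U₂ Y₂
  simp only [mutualInfo, condMutualInfo, condEntropy]
  linarith

/-- `I(U₁; Y₂ | U₂) ≤ I(U₁; Y₂ | X₂)`. -/
theorem condMutualInfo_U₁_Y₂_le (W : Channel 𝒳₁ 𝒳₂ 𝒴₁ 𝒴₂ 𝒴₃) (P : InputDist 𝒰₁ 𝒳₁ 𝒰₂ 𝒳₂) :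
    condMutualInfo (joint W P) U₁ Y₂ U₂ ≤ condMutualInfo (joint W P) U₁ Y₂ X₂ := by
  have h1 := entropy_U₁_U₂ W P
  have h2 := entropy_U₁_X₂ W P
  -- By independence H(U₁|U₂) = H(U₁|X₂) = H(U₁). Also H(U₁|Y₂,X₂) = H(U₁|Y₂,X₂,U₂) ≤ H(U₁|Y₂,U₂),
  -- the equality by this Markov chain and the inequality by submodularity.
  have h3 := entropy_factor (joint_nonneg W P) U₂ U₁ (fun ω => (Y₂ ω, X₂ ω))
    (fun u₂ c => P.pU₂ u₂ * P.pX₂ u₂ c.2)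
    (fun u₁ c => ∑ x₁, P.pU₁ u₁ * P.pX₁ u₁ x₁ * W.W₂ x₁ c.2 c.1) (law_U₂_U₁_X₂_Y₂ W P)
  have h4 := entropy_submodular (joint_nonneg W P) U₁ X₂ (fun ω => (Y₂ ω, U₂ ω))
  have h5 : entropy (joint W P) (fun ω => (U₂ ω, U₁ ω, Y₂ ω, X₂ ω)) =
      entropy (joint W P) (fun ω => (U₁ ω, X₂ ω, Y₂ ω, U₂ ω)) :=
    entropy_equiv _ ⟨fun (a, b, c, d) => (b, d, c, a), fun (b, d, c, a) => (a, b, c, d),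
      fun _ => rfl, fun _ => rfl⟩ fun _ => rfl
  have h6 : entropy (joint W P) (fun ω => (U₂ ω, Y₂ ω, X₂ ω)) =
      entropy (joint W P) (fun ω => (X₂ ω, Y₂ ω, U₂ ω)) :=
    entropy_equiv _ ⟨fun (a, b, c) => (c, b, a), fun (c, b, a) => (a, b, c),
      fun _ => rfl, fun _ => rfl⟩ fun _ => rfl
  simp only [condMutualInfo, condEntropy]
  linarith

/-- `I(X₁; Y₂ | U₂) = I(U₁; Y₂ | U₂) + I(X₁; Y₂ | U₁, U₂)`. -/
theorem condMutualInfo_X₁_Y₂ (W : Channel 𝒳₁ 𝒳₂ 𝒴₁ 𝒴₂ 𝒴₃) (P : InputDist 𝒰₁ 𝒳₁ 𝒰₂ 𝒳₂) :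
    condMutualInfo (joint W P) X₁ Y₂ U₂ = condMutualInfo (joint W P) U₁ Y₂ U₂ +
      condMutualInfo (joint W P) X₁ Y₂ (fun ω => (U₁ ω, U₂ ω)) := by
  -- The Markov chain gives I(U₁;Y₂|X₁,U₂) = 0, so adjoining `U₁` to `X₁` costs nothing in the chain
  -- rule.
  have h1 := markov_U₁_Y₂ W P
  have h2 : entropy (joint W P) (fun ω => (U₁ ω, Y₂ ω, X₁ ω, U₂ ω)) =
      entropy (joint W P) (fun ω => (X₁ ω, Y₂ ω, U₁ ω, U₂ ω)) :=
    entropy_equiv _ ⟨fun (a, b, c, d) => (c, b, a, d), fun (c, b, a, d) => (a, b, c, d),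
      fun _ => rfl, fun _ => rfl⟩ fun _ => rfl
  have h3 := entropy_left_comm (joint W P) U₁ X₁ U₂
  have h4 := entropy_left_comm (joint W P) Y₂ X₁ U₂
  have h5 := entropy_left_comm (joint W P) U₁ Y₂ U₂
  simp only [condMutualInfo, condEntropy]
  linarith

/-- `I(X₁, U₂; Y₂) = I(U₁; Y₂) + I(X₁, U₂; Y₂ | U₁)`. -/
theorem mutualInfo_X₁_U₂_Y₂ (W : Channel 𝒳₁ 𝒳₂ 𝒴₁ 𝒴₂ 𝒴₃) (P : InputDist 𝒰₁ 𝒳₁ 𝒰₂ 𝒳₂) :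
    mutualInfo (joint W P) (fun ω => (X₁ ω, U₂ ω)) Y₂ = mutualInfo (joint W P) U₁ Y₂ +
      condMutualInfo (joint W P) (fun ω => (X₁ ω, U₂ ω)) Y₂ U₁ := by
  have h1 := markov_U₁_Y₂ W P
  have h2 : entropy (joint W P) (fun ω => (U₁ ω, Y₂ ω, X₁ ω, U₂ ω)) =
      entropy (joint W P) (fun ω => ((X₁ ω, U₂ ω), Y₂ ω, U₁ ω)) :=
    entropy_equiv _ ⟨fun (a, b, c, d) => ((c, d), b, a), fun ((c, d), b, a) => (a, b, c, d),
      fun _ => rfl, fun _ => rfl⟩ fun _ => rfl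
  have h3 := entropy_swap (joint W P) U₁ (fun ω => (X₁ ω, U₂ ω))
  have h4 := entropy_swap (joint W P) Y₂ (fun ω => (X₁ ω, U₂ ω))
  have h5 := entropy_swap (joint W P) U₁ Y₂
  simp only [mutualInfo, condMutualInfo, condEntropy]
  linarith

/-- `I(X₁; Y₁) = I(U₁; Y₁) + I(X₁; Y₁ | U₁)`. -/
theorem mutualInfo_X₁_Y₁ (W : Channel 𝒳₁ 𝒳₂ 𝒴₁ 𝒴₂ 𝒴₃) (P : InputDist 𝒰₁ 𝒳₁ 𝒰₂ 𝒳₂) :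
    mutualInfo (joint W P) X₁ Y₁ = mutualInfo (joint W P) U₁ Y₁ +
      condMutualInfo (joint W P) X₁ Y₁ U₁ := by
  have h1 := markov_U₁_Y₁ W P
  have h2 : entropy (joint W P) (fun ω => (U₁ ω, Y₁ ω, X₁ ω)) =
      entropy (joint W P) (fun ω => (X₁ ω, Y₁ ω, U₁ ω)) :=
    entropy_equiv _ ⟨fun (a, b, c) => (c, b, a), fun (c, b, a) => (a, b, c),
      fun _ => rfl, fun _ => rfl⟩ fun _ => rfl
  have h3 := entropy_swap (joint W P) U₁ X₁
  have h4 := entropy_swap (joint W P) Y₁ X₁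
  have h5 := entropy_swap (joint W P) U₁ Y₁
  simp only [mutualInfo, condMutualInfo, condEntropy]
  linarith

/-- `I(U₁, U₂; Y₂) = I(U₂; Y₂) + I(U₁; Y₂ | U₂)`. -/
theorem mutualInfo_U₁_U₂_Y₂ (W : Channel 𝒳₁ 𝒳₂ 𝒴₁ 𝒴₂ 𝒴₃) (P : InputDist 𝒰₁ 𝒳₁ 𝒰₂ 𝒳₂) :
    mutualInfo (joint W P) (fun ω => (U₁ ω, U₂ ω)) Y₂ =
      mutualInfo (joint W P) U₂ Y₂ + condMutualInfo (joint W P) U₁ Y₂ U₂ := by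
  have h1 : entropy (joint W P) (fun ω => ((U₁ ω, U₂ ω), Y₂ ω)) =
      entropy (joint W P) (fun ω => (U₁ ω, Y₂ ω, U₂ ω)) :=
    entropy_equiv _ ⟨fun ((a, b), c) => (a, c, b), fun (a, c, b) => ((a, b), c),
      fun _ => rfl, fun _ => rfl⟩ fun _ => rfl
  have h2 := entropy_swap (joint W P) U₂ Y₂
  simp only [mutualInfo, condMutualInfo, condEntropy]
  linarith

/-- The input distribution in which `U₁` is erased with probability `1 - l`. -/
def InputDist.eraseU₁ (P : InputDist 𝒰₁ 𝒳₁ 𝒰₂ 𝒳₂) (l : ℝ) (hl0 : 0 ≤ l) (hl1 : l ≤ 1) :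
    InputDist (Option 𝒰₁) 𝒳₁ 𝒰₂ 𝒳₂ where
  pU₁ := ⟨fun o => o.elim (1 - l) (fun u => l * P.pU₁ u), by
    rintro (_ | u)
    · exact sub_nonneg.2 hl1
    · exact mul_nonneg hl0 (P.pU₁.2.1 u), by
    simp [Fintype.sum_option, ← Finset.mul_sum]⟩
  -- After an erasure `X₁` gets its marginal law, so that the law of everything but `U₁` is
  -- preserved.
  pX₁ o := o.elim (mixture P.pU₁ P.pX₁) P.pX₁
  pU₂ := P.pU₂
  pX₂ := P.pX₂

theorem joint_eraseU₁ (W : Channel 𝒳₁ 𝒳₂ 𝒴₁ 𝒴₂ 𝒴₃) (P : InputDist 𝒰₁ 𝒳₁ 𝒰₂ 𝒳₂) (l : ℝ)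
    (hl0 : 0 ≤ l) (hl1 : l ≤ 1) :
    joint W (P.eraseU₁ l hl0 hl1) = erase l (joint W P) := by
  ext ⟨u₁, x₁, u₂, x₂, y₁, y₂, y₃⟩
  rcases u₁ with _ | u₁
  · change (1 - l) * (∑ u₁, P.pU₁ u₁ * P.pX₁ u₁ x₁) * P.pU₂ u₂ * P.pX₂ u₂ x₂ *
      (W.W₁ x₁ y₁ * W.W₂ x₁ x₂ y₂ * W.W₃ x₂ y₃) = (1 - l) * ∑ u₁,
        P.pU₁ u₁ * P.pX₁ u₁ x₁ * P.pU₂ u₂ * P.pX₂ u₂ x₂ *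
        (W.W₁ x₁ y₁ * W.W₂ x₁ x₂ y₂ * W.W₃ x₂ y₃)
    simp only [← Finset.sum_mul]
    ring
  · change l * P.pU₁ u₁ * P.pX₁ u₁ x₁ * P.pU₂ u₂ * P.pX₂ u₂ x₂ *
      (W.W₁ x₁ y₁ * W.W₂ x₁ x₂ y₂ * W.W₃ x₂ y₃) = l * (P.pU₁ u₁ * P.pX₁ u₁ x₁ * P.pU₂ u₂ *
        P.pX₂ u₂ x₂ * (W.W₁ x₁ y₁ * W.W₂ x₁ x₂ y₂ * W.W₃ x₂ y₃))
    ring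

/-- Erasure scales the information about `U₁` by `l`, and leaves the information between the
other variables unchanged. -/
theorem eraseU₁_info (W : Channel 𝒳₁ 𝒳₂ 𝒴₁ 𝒴₂ 𝒴₃) (P : InputDist 𝒰₁ 𝒳₁ 𝒰₂ 𝒳₂)
    (l : ℝ) (hl0 : 0 ≤ l) (hl1 : l ≤ 1) :
    let p := joint W P
    let p' := joint W (P.eraseU₁ l hl0 hl1)
    mutualInfo p' U₁ Y₁ = l * mutualInfo p U₁ Y₁ ∧
    mutualInfo p' U₁ Y₂ = l * mutualInfo p U₁ Y₂ ∧
    condMutualInfo p' U₁ Y₂ U₂ = l * condMutualInfo p U₁ Y₂ U₂ ∧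
    mutualInfo p' X₁ Y₁ = mutualInfo p X₁ Y₁ ∧
    condMutualInfo p' X₁ Y₂ U₂ = condMutualInfo p X₁ Y₂ U₂ ∧
    mutualInfo p' (fun ω => (X₁ ω, U₂ ω)) Y₂ = mutualInfo p (fun ω => (X₁ ω, U₂ ω)) Y₂ ∧
    mutualInfo p' U₂ Y₂ = mutualInfo p U₂ Y₂ ∧
    mutualInfo p' X₂ Y₃ = mutualInfo p X₂ Y₃ ∧
    condMutualInfo p' X₂ Y₃ U₂ = condMutualInfo p X₂ Y₃ U₂ := by
  intro p p'
  have hp' : p' = erase l p := joint_eraseU₁ W P l hl0 hl1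
  have hp : ∑ ω, p ω = 1 := sum_joint W P
  rw [hp']
  exact ⟨mutualInfo_erase_fst l hp fun t => t.2.2.2.1,
    mutualInfo_erase_fst l hp fun t => t.2.2.2.2.1,
    condMutualInfo_erase_fst l hp (fun t => t.2.2.2.2.1) fun t => t.2.1,
    mutualInfo_erase l p (fun t => t.1) fun t => t.2.2.2.1,
    condMutualInfo_erase l p (fun t => t.1) (fun t => t.2.2.2.2.1) fun t => t.2.1,
    mutualInfo_erase l p (fun t => (t.1, t.2.1)) fun t => t.2.2.2.2.1,
    mutualInfo_erase l p (fun t => t.2.1) fun t => t.2.2.2.2.1,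
    mutualInfo_erase l p (fun t => t.2.2.1) fun t => t.2.2.2.2.2,
    condMutualInfo_erase l p (fun t => t.2.2.1) (fun t => t.2.2.2.2.2) fun t => t.2.1⟩

end Channel

/-! ### Trading rates: comparison of the regions -/

section Regions

variable {𝒰₁ 𝒰₂ : Type} {𝒳₁ 𝒳₂ 𝒴₁ 𝒴₂ 𝒴₃ : Type*} [Fintype 𝒰₁] [Fintype 𝒳₁] [Fintype 𝒰₂]
  [Fintype 𝒳₂] [Fintype 𝒴₁] [Fintype 𝒴₂] [Fintype 𝒴₃]

theorem ObliviousLessNoisy.mutualInfo_le {W : Channel 𝒳₁ 𝒳₂ 𝒴₁ 𝒴₂ 𝒴₃}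
    (h : ObliviousLessNoisy W) (P : InputDist 𝒰₁ 𝒳₁ 𝒰₂ 𝒳₂) :
    mutualInfo (joint W P) U₁ Y₁ ≤ mutualInfo (joint W P) U₁ Y₂ := by
  have h1 := h 𝒰₁ P.marginal₁ (mixture P.pU₂ P.pX₂)
  rw [← law_broadcast] at h1
  simpa only [mutualInfo, condEntropy, ← entropy_comp] using h1

theorem CognizantLessNoisy.condMutualInfo_le {W : Channel 𝒳₁ 𝒳₂ 𝒴₁ 𝒴₂ 𝒴₃}
    (h : CognizantLessNoisy W) (P : InputDist 𝒰₁ 𝒳₁ 𝒰₂ 𝒳₂) :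
    condMutualInfo (joint W P) U₁ Y₂ X₂ ≤ mutualInfo (joint W P) U₁ Y₁ := by
  have h1 := h 𝒰₁ P.marginal₁ (mixture P.pU₂ P.pX₂)
  rw [← law_broadcast] at h1
  simpa only [mutualInfo, condMutualInfo, condEntropy, ← entropy_comp] using h1

/-- An erasure probability `1 - l` that removes the part `s` of the amount `a`. -/
theorem exists_erasure_parameter {s a : ℝ} (hs : 0 ≤ s) (hsa : s ≤ a) :
    ∃ l : ℝ, 0 ≤ l ∧ l ≤ 1 ∧ (1 - l) * a = s := by
  rcases hs.eq_or_lt with rfl | hs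
  · exact ⟨1, zero_le_one, le_rfl, by simp⟩
  · have ha : 0 < a := hs.trans_le hsa
    refine ⟨1 - s / a, sub_nonneg.2 ((div_le_one ha).2 hsa),
      sub_le_self 1 (div_nonneg hs.le ha.le), ?_⟩
    field_simp
    ring

theorem superpositionRegion₁_subset (W : Channel 𝒳₁ 𝒳₂ 𝒴₁ 𝒴₂ 𝒴₃) :
    superpositionRegion₁ W ⊆ splitRegion₁ W := by
  rintro ⟨R₁, R₂, R₃⟩ ⟨𝒰₁, 𝒰₂, _, _, P, h1, h2, h3, h4, h5, h6, h7⟩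
  exact ⟨𝒰₁, 𝒰₂, _, _, P, h1, h2, h3, h4, h6, by linarith, by linarith⟩

theorem superpositionRegion₂_subset (W : Channel 𝒳₁ 𝒳₂ 𝒴₁ 𝒴₂ 𝒴₃) :
    superpositionRegion₂ W ⊆ splitRegion₂ W := by
  rintro ⟨R₁, R₂, R₃⟩ ⟨𝒰₁, 𝒰₂, _, _, P, h1, h2, h3, h4, h5, h6, h7⟩
  exact ⟨𝒰₁, 𝒰₂, _, _, P, h1, h2, h3, h5, h6, by linarith, h7, by linarith⟩

theorem ObliviousLessNoisy.splitRegion₁_subset {W : Channel 𝒳₁ 𝒳₂ 𝒴₁ 𝒴₂ 𝒴₃}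
    (h : ObliviousLessNoisy W) : splitRegion₁ W ⊆ superpositionRegion₁ W := by
  rintro ⟨R₁, R₂, R₃⟩ ⟨𝒰₁, 𝒰₂, _, _, P, h1, h2, h3, h4, h5, h6, h7⟩
  -- The amount removed is the slack I(U₁;Y₁) - R₁, so that the erased variable satisfies l I(U₁;Y₁)
  -- = R₁.
  obtain ⟨l, hl0, hl1, hl⟩ := exists_erasure_parameter (sub_nonneg.2 h4) (sub_le_self _ h1)
  obtain ⟨e1, e2, e3, -, e5, e6, -, e8, e9⟩ := eraseU₁_info W P l hl0 hl1
  have i1 := h.mutualInfo_le P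
  have i2 := i1.trans (mutualInfo_U₁_Y₂_le W P)
  have c1 := condMutualInfo_X₁_Y₂ W P
  have c1' := condMutualInfo_X₁_Y₂ W (P.eraseU₁ l hl0 hl1)
  have c2 := mutualInfo_X₁_U₂_Y₂ W P
  have c2' := mutualInfo_X₁_U₂_Y₂ W (P.eraseU₁ l hl0 hl1)
  -- The slack is (1-l) I(U₁;Y₁); `j1` bounds it by the gain in the bound on R₂ + R₃, and `j2` by
  -- the gain in the bound on R₂.
  have j1 := mul_le_mul_of_nonneg_left i1 (sub_nonneg.2 hl1)
  have j2 := mul_le_mul_of_nonneg_left i2 (sub_nonneg.2 hl1)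
  refine ⟨Option 𝒰₁, 𝒰₂, inferInstance, _, P.eraseU₁ l hl0 hl1, h1, h2, h3, ?_, ?_, ?_, ?_⟩
  · linarith
  · linarith
  · linarith
  · linarith

theorem CognizantLessNoisy.splitRegion₂_subset {W : Channel 𝒳₁ 𝒳₂ 𝒴₁ 𝒴₂ 𝒴₃}
    (h : CognizantLessNoisy W) : splitRegion₂ W ⊆ superpositionRegion₂ W := by
  rintro ⟨R₁, R₂, R₃⟩ ⟨𝒰₁, 𝒰₂, _, _, P, h1, h2, h3, h4, h5, h6, h7, h8⟩
  -- The amount removed from I(U₁;Y₂|U₂) is the excess of R₁ over I(X₁;Y₁|U₁), or 0 if there is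
  -- none. The bound on R₁ + R₂ shows that this much is available.
  obtain ⟨l, hl0, hl1, hl⟩ := exists_erasure_parameter
    (s := max 0 (R₁ - condMutualInfo (joint W P) X₁ Y₁ U₁)) (le_max_left _ _)
    (a := condMutualInfo (joint W P) U₁ Y₂ U₂) (max_le (h2.trans h4) (by linarith))
  obtain ⟨e1, -, e3, e4, -, -, e7, e8, e9⟩ := eraseU₁_info W P l hl0 hl1
  have i1 := (condMutualInfo_U₁_Y₂_le W P).trans (h.condMutualInfo_le P)
  have c1 := mutualInfo_X₁_Y₁ W P
  have c1' := mutualInfo_X₁_Y₁ W (P.eraseU₁ l hl0 hl1)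
  have c2 := mutualInfo_U₁_U₂_Y₂ W P
  have c2' := mutualInfo_U₁_U₂_Y₂ W (P.eraseU₁ l hl0 hl1)
  have j1 := mul_le_mul_of_nonneg_left i1 (sub_nonneg.2 hl1)
  have m1 := le_max_right 0 (R₁ - condMutualInfo (joint W P) X₁ Y₁ U₁)
  refine ⟨Option 𝒰₁, 𝒰₂, inferInstance, _, P.eraseU₁ l hl0 hl1, h1, h2, h3, ?_, ?_, ?_, ?_⟩
  · linarith
  -- The loss must fit into the slack of R₂: the bound on R₂ handles loss 0, and the bound on R₁ +
  -- R₂ handles a positive excess.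
  · have := max_le (c := condMutualInfo (joint W P) U₁ Y₂ U₂ - R₂) (sub_nonneg.2 h4)
      (show R₁ - condMutualInfo (joint W P) X₁ Y₁ U₁ ≤ _ by linarith)
    linarith
  · linarith
  -- The same split, with the bounds on R₂ + R₃ and on R₁ + R₂ + R₃.
  · have := max_le (c := mutualInfo (joint W P) (fun ω => (U₁ ω, U₂ ω)) Y₂ +
      condMutualInfo (joint W P) X₂ Y₃ U₂ - (R₂ + R₃)) (sub_nonneg.2 h7)
      (show R₁ - condMutualInfo (joint W P) X₁ Y₁ U₁ ≤ _ by linarith)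
    linarith

end Regions

end BIC

end

theorem mainTheorem2 {𝒳₁ 𝒳₂ 𝒴₁ 𝒴₂ 𝒴₃ : Type*}
    [Fintype 𝒳₁] [Fintype 𝒳₂] [Fintype 𝒴₁] [Fintype 𝒴₂] [Fintype 𝒴₃]
    (W : BIC.Channel 𝒳₁ 𝒳₂ 𝒴₁ 𝒴₂ 𝒴₃) :
    (BIC.ObliviousLessNoisy W → BIC.splitRegion₁ W = BIC.superpositionRegion₁ W) ∧
    (BIC.CognizantLessNoisy W → BIC.splitRegion₂ W = BIC.superpositionRegion₂ W) := by
  exact ⟨fun h => h.splitRegion₁_subset.antisymm (BIC.superpositionRegion₁_subset W),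
    fun h => h.splitRegion₂_subset.antisymm (BIC.superpositionRegion₂_subset W)⟩
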